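/- An alphabet is a finite set of symbols, and a family of languages is a collection of languages over alphabets. A full trio is a family of languages closed under homomorphism, inverse homomorphism and intersection with regular languages (homomorphisms are arbitrary homomorphisms $\Sigma^* \to \Gamma^*$ between free monoids, possibly erasing letters). For a word $w$ over $\Sigma = \{a_1,\dots,a_n\}$ the Parikh image of $w$ is $\psi(w) = (|w|_{a_1},\dots,|w|_{a_n}) \in \mathbb{N}_0^n$; a language $L$ is semilinear if $\psi(L) = \{\psi(w) \mid w \in L\}$ is a finite union of linear sets $\{\vec v_0 + i_1 \vec v_1 + \cdots + i_m \vec v_m \mid i_1,\dots,i_m \in \mathbb{N}_0\}$, and a family is semilinear if all its languages are. For families $\mathcal{L}_1, \mathcal{L}_2$ let $\mathcal{L}_1 \wedge \mathcal{L}_2 = \{L_1 \cap L_2 \mid L_1 \in \mathcal{L}_1, L_2 \in \mathcal{L}_2\}$. Let $\hat{\mathcal{H}}(\mathcal{L})$ be the smallest family containing $\mathcal{L}$ that is closed under homomorphism, and $\hat{\mathcal{T}}(\mathcal{L})$ the smallest full trio containing $\mathcal{L}$. Let $\mathrm{NCM}$ be the family of languages accepted, for some $k, l \in \mathbb{N}_0$,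 by one-way nondeterministic finite-state machines with $k$ counters (each holding a non-negative integer, initially $0$) whose transitions may read an input letter or no input, test each counter for zero, and change each counter by $+1$, $0$ or $-1$; a word is accepted if some computation reads all of it and ends in an accepting state; and the machine is required to be $l$-reversal-bounded: in every accepting computation, each counter makes at most $l$ changes between non-decreasing and non-increasing. **Proposition.** If $\mathcal{L}$ is a semilinear full trio, then $$\hat{\mathcal{T}}(\mathcal{L} \wedge \mathrm{NCM}) = \hat{\mathcal{H}}(\mathcal{L} \wedge \mathrm{NCM}),$$ and this family is a semilinear full trio. -/

import Mathlib

/-- A family of languages: for every finite alphabet `α`, a set of languages over `α`. -/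
abbrev LanguageFamily : Type 1 := ∀ (α : Type) [Finite α], Set (Language α)

/-- The image `h(L)` of `L ⊆ α*` under the homomorphism `h : α* → β*` that is determined by
the words `h a`, for the letters `a` of `α`. -/
def Language.homImage {α β : Type} (h : α → List β) (L : Language α) : Language β :=
  {v | ∃ w ∈ L, w.flatMap h = v}

/-- The inverse image `h⁻¹(L)` of `L ⊆ β*` under the homomorphism `h : α* → β*` that is
determined by the words `h a`, for the letters `a` of `α`. -/
def Language.homPreimage {α β : Type} (h : α → List β) (L : Language β) : Language α :=
  {w | w.flatMap h ∈ L}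

open Classical in
/-- The Parikh vector of a word: the number of occurrences of each letter. -/
noncomputable def parikh {α : Type} (w : List α) : α → ℕ := fun a => w.count a

/-- A language is semilinear if its Parikh image is a semilinear set of vectors. -/
def Language.IsSemilinear {α : Type} (L : Language α) : Prop :=
  IsSemilinearSet {v : α → ℕ | ∃ w ∈ L, parikh w = v}

/-- A one-way nondeterministic machine with `k` counters over the input alphabet `α`, with set
of states `σ`. A transition depends on the state, on the input letter (`none` for a transition
that reads no input) and on which of the counters are zero (`z i = true` means that counter `i`
is zero); it gives a new state and adds `1`, `0` or `-1` to each counter. -/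
structure CounterMachine (α σ : Type) (k : ℕ) where
  step : σ → Option α → (Fin k → Bool) → Set (σ × (Fin k → SignType))
  start : σ
  accept : Set σ

namespace CounterMachine

variable {α σ : Type} {k : ℕ}

/-- `M.Run q c w ds q' c'`: there is a computation of `M` from state `q` with counter values `c`
to state `q'` with counter values `c'` that reads the word `w` and in which the successive steps
change the counters by the entries of `ds`. Counter values are natural numbers, so a counter that
is zero cannot be decreased. -/
inductive Run (M : CounterMachine α σ k) :
    σ → (Fin k → ℕ) → List α → List (Fin k → SignType) → σ → (Fin k → ℕ) → Prop
  | nil (q : σ) (c : Fin k → ℕ) : Run M q c [] [] q c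
  | cons {q r q' : σ} {c e c' : Fin k → ℕ} {a : Option α} {d : Fin k → SignType}
      {w : List α} {ds : List (Fin k → SignType)}
      (hstep : (r, d) ∈ M.step q a (fun i => decide (c i = 0)))
      (hcount : ∀ i, (e i : ℤ) = (c i : ℤ) + (d i : ℤ))
      (hrun : Run M r e w ds q' c') :
      Run M q c (a.toList ++ w) (d :: ds) q' c'

/-- `M.AcceptingRun w ds`: there is an accepting computation of `M` on the input `w` whose
successive steps change the counters by the entries of `ds`. It starts in the start state with all
counters zero, reads the whole input, and ends in an accepting state. -/
def AcceptingRun (M : CounterMachine α σ k) (w : List α) (ds : List (Fin k → SignType)) : Prop :=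
  ∃ q ∈ M.accept, ∃ c : Fin k → ℕ, M.Run M.start 0 w ds q c

/-- The language accepted by `M`. -/
def accepts (M : CounterMachine α σ k) : Language α :=
  {w | ∃ ds, M.AcceptingRun w ds}

/-- The number of positions at which a list has two different adjacent entries. -/
def alternations : List SignType → ℕ
  | [] => 0
  | [_] => 0
  | a :: b :: l => (if a = b then 0 else 1) + alternations (b :: l)

/-- The number of reversals in a sequence of changes of one counter, that is, the number of
changes between non-decreasing and non-increasing; steps that leave the counter unchanged do not
matter. -/
def reversals (l : List SignType) : ℕ := alternations (l.filter (fun s => s ≠ 0))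

/-- `M` is `l`-reversal-bounded: in every accepting computation, each counter makes at most `l`
reversals. -/
def ReversalBounded (M : CounterMachine α σ k) (l : ℕ) : Prop :=
  ∀ w ds, M.AcceptingRun w ds → ∀ i, reversals (ds.map (fun d => d i)) ≤ l

end CounterMachine

/-- The family of languages accepted by one-way nondeterministic `l`-reversal-bounded `k`-counter
machines with finitely many states, for some `k` and `l`. -/
def NCM : LanguageFamily := fun α _ =>
  {L | ∃ (k l : ℕ) (σ : Type) (_ : Finite σ) (M : CounterMachine α σ k),
    M.ReversalBounded l ∧ M.accepts = L}

namespace LanguageFamily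

/-- Inclusion of families of languages. -/
def Contained (F G : LanguageFamily) : Prop :=
  ∀ (α : Type) [Finite α] (L : Language α), L ∈ F α → L ∈ G α

/-- The family of all intersections of a language in `F` with a language in `G`. -/
def wedge (F G : LanguageFamily) : LanguageFamily := fun α _ =>
  {L | ∃ L₁ ∈ F α, ∃ L₂ ∈ G α, L = L₁ ⊓ L₂}

/-- Closure under arbitrary homomorphisms. -/
def ClosedUnderHom (F : LanguageFamily) : Prop :=
  ∀ (α β : Type) [Finite α] [Finite β] (h : α → List β) (L : Language α),
    L ∈ F α → L.homImage h ∈ F β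

/-- Closure under arbitrary inverse homomorphisms. -/
def ClosedUnderInvHom (F : LanguageFamily) : Prop :=
  ∀ (α β : Type) [Finite α] [Finite β] (h : α → List β) (L : Language β),
    L ∈ F β → L.homPreimage h ∈ F α

/-- Closure under intersection with regular languages. -/
def ClosedUnderInterRegular (F : LanguageFamily) : Prop :=
  ∀ (α : Type) [Finite α] (L R : Language α), L ∈ F α → R.IsRegular → L ⊓ R ∈ F α

/-- A full trio is a family of languages closed under homomorphism, inverse homomorphism and
intersection with regular languages. -/
structure IsFullTrio (F : LanguageFamily) : Prop where
  hom : F.ClosedUnderHom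
  invHom : F.ClosedUnderInvHom
  interRegular : F.ClosedUnderInterRegular

/-- A family of languages is semilinear if all languages in it are. -/
def IsSemilinear (F : LanguageFamily) : Prop :=
  ∀ (α : Type) [Finite α] (L : Language α), L ∈ F α → L.IsSemilinear

/-- The smallest family that contains `F` and is closed under homomorphism: the intersection of
all such families. -/
def hatH (F : LanguageFamily) : LanguageFamily := fun α _ =>
  {L | ∀ G : LanguageFamily, F.Contained G → G.ClosedUnderHom → L ∈ G α}

/-- The smallest full trio that contains `F`: the intersection of all such full trios. -/
def hatT (F : LanguageFamily) : LanguageFamily := fun α _ =>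
  {L | ∀ G : LanguageFamily, F.Contained G → G.IsFullTrio → L ∈ G α}

end LanguageFamily

/-! Write `homClosure` for the family of images h(L₁ ∩ L₂). Homomorphisms compose, so it is the
closure under homomorphism; every full trio containing the intersections contains it. It remains to
see that it is a full trio and semilinear.

Full trio: h(L) ∩ R = h(L ∩ h⁻¹(R)), and g⁻¹(h(L)) is obtained from L by an inverse projection,
intersection with a regular language that synchronizes g and h, and another projection
(`exists_isRegular_synchronizing`). Thus counter languages need only be closed under inverse images
of letter-or-erase maps.

Semilinearity: a bounded number of reversals cuts the history of each counter into boundedly many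
phases, in which it is monotone and its zero test is constant. A finite automaton can check steps
labelled with phases, except for the counter values. By monotonicity these need checking only at
phase boundaries (`phaseSteps_iff`), where they are linear in the Parikh vector. So a semilinear
Parikh image is intersected with a semilinear set and mapped linearly (`isSemilinear_wedge_NCM`). -/

/-! ### Parikh vectors and semilinear sets -/

/-- The additive map on vectors with natural coefficients that is determined by weights of the
coordinates. -/
noncomputable def weightHom {α N : Type} [Finite α] [AddCommMonoid N] (g : α → N) :
    (α → ℕ) →+ N :=
  letI := Fintype.ofFinite α
  { toFun := fun x => ∑ a, x a • g a
    map_zero' := by simp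
    map_add' := fun x y => by simp [add_smul, Finset.sum_add_distrib] }

theorem parikh_cons {α : Type} [DecidableEq α] (a : α) (w : List α) :
    parikh (a :: w) = Pi.single a 1 + parikh w := by
  classical
  funext b
  by_cases h : a = b
  · subst h
    simp [parikh, add_comm]
  · simp [parikh, h, Ne.symm h]

theorem parikh_append {α : Type} (v w : List α) : parikh (v ++ w) = parikh v + parikh w := by
  funext b
  simp [parikh, List.count_append]

theorem weightHom_parikh {α N : Type} [Finite α] [AddCommMonoid N] (g : α → N) (w : List α) :
    weightHom g (parikh w) = (w.map g).sum := by
  classical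
  let _ := Fintype.ofFinite α
  induction w with
  | nil =>
    have : parikh ([] : List α) = 0 := by funext b; simp [parikh]
    rw [this, map_zero]
    simp
  | cons a w ih =>
    rw [parikh_cons, map_add, ih, List.map_cons, List.sum_cons]
    congr 1
    change ∑ b, (Pi.single a 1 : α → ℕ) b • g b = g a
    rw [Finset.sum_eq_single a]
    · simp
    · intro b _ hb
      simp [hb]
    · simp

theorem parikh_flatMap {α β : Type} [Finite α] (h : α → List β) (w : List α) :
    parikh (w.flatMap h) = weightHom (fun a => parikh (h a)) (parikh w) := by
  rw [weightHom_parikh]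
  induction w with
  | nil => funext b; simp [parikh]
  | cons a w ih => rw [List.flatMap_cons, parikh_append, ih, List.map_cons, List.sum_cons]

theorem Language.IsSemilinear.homImage {α β : Type} [Finite α] {L : Language α}
    (hL : L.IsSemilinear) (h : α → List β) : (L.homImage h).IsSemilinear := by
  have := IsSemilinearSet.image hL (weightHom fun a => parikh (h a))
  unfold Language.IsSemilinear
  convert this using 1
  ext v
  constructor
  · rintro ⟨_, ⟨w, hw, rfl⟩, rfl⟩
    exact ⟨_, ⟨w, hw, rfl⟩, (parikh_flatMap h w).symm⟩
  · rintro ⟨_, ⟨w, hw, rfl⟩, rfl⟩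
    exact ⟨_, ⟨w, hw, rfl⟩, parikh_flatMap h w⟩

theorem isSemilinearSet_pos_int : IsSemilinearSet {z : ℤ | 0 < z} := by
  have h := (IsSemilinearSet.closure_of_finite (Set.finite_singleton (1 : ℤ))).vadd 1
  convert h using 1
  ext z
  simp only [Set.mem_ofPred_eq, Set.mem_vadd_set, SetLike.mem_coe,
    AddSubmonoid.mem_closure_singleton, vadd_eq_add]
  constructor
  · intro hz
    exact ⟨z - 1, ⟨(z - 1).toNat, by simp; omega⟩, by ring⟩
  · rintro ⟨_, ⟨n, rfl⟩, rfl⟩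
    simp
    omega

/-! ### Regular languages -/

theorem NFA.isRegular_accepts {α σ : Type} [Finite σ] (M : NFA α σ) : M.accepts.IsRegular :=
  ⟨Set σ, Fintype.ofFinite _, M.toDFA, M.toDFA_correct⟩

theorem NFA.cons_mem_acceptsFrom_singleton {α σ : Type} (M : NFA α σ) (s : σ) (a : α)
    (w : List α) :
    a :: w ∈ M.acceptsFrom {s} ↔ ∃ t ∈ M.step s a, w ∈ M.acceptsFrom {t} := by
  rw [NFA.cons_mem_acceptsFrom, NFA.stepSet_singleton]
  simp only [NFA.mem_acceptsFrom]
  constructor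
  · rintro ⟨r, hr, h⟩
    obtain ⟨t, ht, h⟩ := NFA.mem_evalFrom_iff_exists.1 h
    exact ⟨t, ht, r, hr, h⟩
  · rintro ⟨t, ht, r, hr, h⟩
    exact ⟨r, hr, NFA.mem_evalFrom_iff_exists.2 ⟨t, ht, h⟩⟩

theorem Language.IsRegular.homPreimage {α β : Type} {R : Language β} (hR : R.IsRegular)
    (h : α → List β) : (R.homPreimage h).IsRegular := by
  obtain ⟨σ, _, M, rfl⟩ := hR
  refine ⟨σ, inferInstance, ⟨fun s a => M.evalFrom s (h a), M.start, M.accept⟩, ?_⟩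
  have key : ∀ (w : List α) (s : σ), List.foldl (fun s a => M.evalFrom s (h a)) s w =
      M.evalFrom s (w.flatMap h) := by
    intro w
    induction w with
    | nil => intro s; rfl
    | cons a w ih => intro s; simp [ih, DFA.evalFrom_of_append]
  ext w
  change List.foldl (fun s a => M.evalFrom s (h a)) M.start w ∈ M.accept ↔
    M.evalFrom M.start (w.flatMap h) ∈ M.accept
  rw [key]

/-! ### Synchronizing two homomorphisms -/

section Synchronizer

variable {α β γ : Type}

/-- The letters of the first alphabet of a triple alphabet. -/
def keepLeft : γ ⊕ β ⊕ α → Option γ := Sum.elim some fun _ => none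

/-- The letters of the third alphabet of a triple alphabet. -/
def keepRight : γ ⊕ β ⊕ α → Option α := Sum.elim (fun _ => none) (Sum.elim (fun _ => none) some)

/-- A finite automaton that reads interleavings of words `u` over `γ`, `v` over `α` and their
common image `g(u) = h(v)`. Its states hold the parts of the images that have been announced but
not yet been read. -/
def synchronizer (g : γ → List β) (h : α → List β) (K : ℕ) :
    NFA (γ ⊕ β ⊕ α) ({l : List β | l.length ≤ K} × {l : List β | l.length ≤ K}) where
  step s x := {t | match x with
    | .inl c => s.1.1 = [] ∧ t.1.1 = g c ∧ t.2 = s.2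
    | .inr (.inl b) => s.1.1 = b :: t.1.1 ∧ s.2.1 = b :: t.2.1
    | .inr (.inr a) => s.2.1 = [] ∧ t.1 = s.1 ∧ t.2.1 = h a}
  start := {(⟨[], Nat.zero_le _⟩, ⟨[], Nat.zero_le _⟩)}
  accept := {(⟨[], Nat.zero_le _⟩, ⟨[], Nat.zero_le _⟩)}

/-- Each letter preserves the equation: loading a buffer moves an image out of the `flatMap`, and a
letter of `β` strips the same head from both buffers. -/
theorem synchronizer_sound (g : γ → List β) (h : α → List β) (K : ℕ)
    (w : List (γ ⊕ β ⊕ α)) : ∀ s, w ∈ (synchronizer g h K).acceptsFrom {s} →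
      s.1.1 ++ (w.flatMap fun x => (keepLeft x).toList).flatMap g =
        s.2.1 ++ (w.flatMap fun x => (keepRight x).toList).flatMap h := by
  induction w with
  | nil =>
    intro s hs
    rw [NFA.nil_mem_acceptsFrom] at hs
    obtain ⟨t, ht, hs⟩ := hs
    obtain rfl : s = _ := (Set.mem_singleton_iff.1 ht).symm.trans hs
    rfl
  | cons x w ih =>
    intro s hs
    rw [NFA.cons_mem_acceptsFrom_singleton] at hs
    obtain ⟨t, ht, hw⟩ := hs
    have := ih t hw
    rcases x with c | b | a
    · obtain ⟨h1, h2, h3⟩ := ht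
      rw [h2, h3] at this
      simpa [keepLeft, keepRight, h1] using this
    · obtain ⟨h1, h2⟩ := ht
      simpa [keepLeft, keepRight, h1, h2] using this
    · obtain ⟨h1, h2, h3⟩ := ht
      rw [h2, h3] at this
      simpa [keepLeft, keepRight, h1] using this

/-- Strip a common head if both buffers are nonempty, otherwise load an empty one. Buffers are
loaded only when empty, so length `K` suffices. The measure drops: loading uses up a letter of
weight `K + 1` and lengthens the left buffer by at most `K`. -/
theorem synchronizer_complete (g : γ → List β) (h : α → List β) (K : ℕ)
    (hg : ∀ c, (g c).length ≤ K) (hh : ∀ a, (h a).length ≤ K) (n : ℕ) :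
    ∀ s (u : List γ) (v : List α),
      (K + 1) * (u.length + v.length) + s.1.1.length < n →
      s.1.1 ++ u.flatMap g = s.2.1 ++ v.flatMap h →
      ∃ w ∈ (synchronizer g h K).acceptsFrom {s},
        w.flatMap (fun x => (keepLeft x).toList) = u ∧
        w.flatMap (fun x => (keepRight x).toList) = v := by
  induction n with
  | zero => intro s u v hn; exact absurd hn (Nat.not_lt_zero _)
  | succ n ih =>
    rintro ⟨⟨p, hp⟩, ⟨q, hq⟩⟩ u v hn he
    simp only at hn he
    have right : ∀ (a : α) (v' : List α), q = [] → v = a :: v' →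
        ∃ w ∈ (synchronizer g h K).acceptsFrom {(⟨p, hp⟩, ⟨q, hq⟩)},
          w.flatMap (fun x => (keepLeft x).toList) = u ∧
          w.flatMap (fun x => (keepRight x).toList) = v := by
      rintro a v' rfl rfl
      obtain ⟨w, hw, h1, h2⟩ := ih (⟨p, hp⟩, ⟨h a, hh a⟩) u v'
        (by simp only [List.length_cons, mul_add] at hn ⊢; omega) (by simpa using he)
      exact ⟨.inr (.inr a) :: w, (NFA.cons_mem_acceptsFrom_singleton _ _ _ _).2
        ⟨(⟨p, hp⟩, ⟨h a, hh a⟩), ⟨rfl, rfl, rfl⟩, hw⟩, by simpa [keepLeft] using h1,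
        by simp [keepRight, ← h2]⟩
    rcases p with _ | ⟨b, p⟩
    · rcases u with _ | ⟨c, u⟩
      · obtain ⟨rfl, hv⟩ : q = [] ∧ v.flatMap h = [] := by simpa using he.symm
        rcases v with _ | ⟨a, v⟩
        · exact ⟨[], (NFA.nil_mem_acceptsFrom _).2 ⟨_, rfl, rfl⟩, rfl, rfl⟩
        · exact right a v rfl rfl
      · obtain ⟨w, hw, h1, h2⟩ := ih (⟨g c, hg c⟩, ⟨q, hq⟩) u v
          (by
            have := hg c
            simp only [List.length_cons, List.length_nil, mul_add] at hn ⊢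
            omega) (by simpa using he)
        exact ⟨.inl c :: w, (NFA.cons_mem_acceptsFrom_singleton _ _ _ _).2
          ⟨(⟨g c, hg c⟩, ⟨q, hq⟩), ⟨rfl, rfl, rfl⟩, hw⟩, by simp [keepLeft, ← h1],
          by simpa [keepRight] using h2⟩
    · rcases q with _ | ⟨b', q⟩
      · rcases v with _ | ⟨a, v⟩
        · simp at he
        · exact right a v rfl rfl
      · obtain ⟨rfl, he'⟩ : b = b' ∧ p ++ u.flatMap g = q ++ v.flatMap h := by simpa using he
        obtain ⟨w, hw, h1, h2⟩ := ih
          (⟨p, (Nat.le_succ _).trans hp⟩, ⟨q, (Nat.le_succ _).trans hq⟩) u v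
          (by simp only [List.length_cons] at hn ⊢; omega) he'
        exact ⟨.inr (.inl b) :: w, (NFA.cons_mem_acceptsFrom_singleton _ _ _ _).2
          ⟨_, ⟨rfl, rfl⟩, hw⟩, by simpa [keepLeft] using h1, by simpa [keepRight] using h2⟩

/-- For homomorphisms `g` and `h` with a common codomain, the relation `g(u) = h(v)` is
recognized, up to an interleaving, by a regular language. -/
theorem exists_isRegular_synchronizing [Finite α] [Finite β] [Finite γ]
    (g : γ → List β) (h : α → List β) :
    ∃ R : Language (γ ⊕ β ⊕ α), R.IsRegular ∧ ∀ u v, u.flatMap g = v.flatMap h ↔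
      ∃ w ∈ R, w.flatMap (fun x => (keepLeft x).toList) = u ∧
        w.flatMap (fun x => (keepRight x).toList) = v := by
  obtain ⟨K₁, hK₁⟩ := (Set.finite_range fun c => (g c).length).bddAbove
  obtain ⟨K₂, hK₂⟩ := (Set.finite_range fun a => (h a).length).bddAbove
  have hg : ∀ c, (g c).length ≤ max K₁ K₂ := fun c => le_max_of_le_left (hK₁ ⟨c, rfl⟩)
  have hh : ∀ a, (h a).length ≤ max K₁ K₂ := fun a => le_max_of_le_right (hK₂ ⟨a, rfl⟩)
  have : Finite {l : List β | l.length ≤ max K₁ K₂} := List.finite_length_le β _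
  refine ⟨_, (synchronizer g h (max K₁ K₂)).isRegular_accepts, fun u v => ⟨fun e => ?_, ?_⟩⟩
  · exact synchronizer_complete g h _ hg hh _ (⟨[], Nat.zero_le _⟩, ⟨[], Nat.zero_le _⟩) u v
      (Nat.lt_succ_self _) e
  · rintro ⟨w, hw, rfl, rfl⟩
    exact synchronizer_sound g h _ w _ hw

end Synchronizer

/-! ### Inverse images of letter-to-letter homomorphisms of counter languages -/

namespace CounterMachine

variable {α σ τ : Type} {k : ℕ}

/-- The machine that ignores the letters that `f` erases, and treats the other ones like their
images. -/
def comapOption (M : CounterMachine α σ k) (f : τ → Option α) : CounterMachine τ σ k where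
  step q x z := {s | match x with
    | none => s ∈ M.step q none z
    | some t => match f t with
      | none => s = (q, 0)
      | some a => s ∈ M.step q (some a) z}
  start := M.start
  accept := M.accept

theorem filter_ne_zero_cons_congr (s : SignType) {l l' : List SignType}
    (h : l.filter (fun s => s ≠ 0) = l'.filter (fun s => s ≠ 0)) :
    (s :: l).filter (fun s => s ≠ 0) = (s :: l').filter (fun s => s ≠ 0) := by
  simp only [List.filter_cons, h]

/-- Erased letters give steps that leave all counters unchanged. These are invisible after the zeros
are filtered out, so the reversal counts agree. -/
theorem Run.of_comapOption {M : CounterMachine α σ k} {f : τ → Option α} {q q' : σ}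
    {c c' : Fin k → ℕ} {w : List τ} {ds : List (Fin k → SignType)}
    (h : (M.comapOption f).Run q c w ds q' c') :
    ∃ ds', M.Run q c (w.flatMap fun t => (f t).toList) ds' q' c' ∧
      ∀ i, (ds'.map (fun d => d i)).filter (fun s => s ≠ 0) =
        (ds.map (fun d => d i)).filter (fun s => s ≠ 0) := by
  induction h with
  | nil q c => exact ⟨[], .nil q c, fun _ => rfl⟩
  | @cons q r q' c e c' x d w ds hstep hcount _ ih =>
    obtain ⟨ds', hrun, hds⟩ := ih
    rcases x with _ | t
    · exact ⟨d :: ds', .cons (a := none) hstep hcount hrun,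
        fun i => filter_ne_zero_cons_congr (d i) (hds i)⟩
    · rcases hft : f t with _ | a
      · simp only [comapOption, hft] at hstep
        obtain ⟨rfl, rfl⟩ := Prod.mk.inj hstep
        obtain rfl : e = c := by
          funext i
          simpa using hcount i
        exact ⟨ds', by simpa [hft] using hrun, fun i => by simpa using hds i⟩
      · simp only [comapOption, hft] at hstep
        exact ⟨d :: ds', by simpa [hft] using Run.cons (a := some a) hstep hcount hrun,
          fun i => filter_ne_zero_cons_congr (d i) (hds i)⟩

theorem Run.comapOption_erased {M : CounterMachine α σ k} {f : τ → Option α} {q q' : σ}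
    {c c' : Fin k → ℕ} (u : List τ) (hu : ∀ t ∈ u, f t = none) {w : List τ}
    {ds : List (Fin k → SignType)} (h : (M.comapOption f).Run q c w ds q' c') :
    ∃ ds', (M.comapOption f).Run q c (u ++ w) ds' q' c' := by
  induction u with
  | nil => exact ⟨ds, h⟩
  | cons t u ih =>
    obtain ⟨ds', h'⟩ := ih fun t ht => hu t (List.mem_cons_of_mem _ ht)
    have hstep : (q, (0 : Fin k → SignType)) ∈
        (M.comapOption f).step q (some t) (fun i => decide (c i = 0)) := by
      simp [comapOption, hu t List.mem_cons_self]
    exact ⟨0 :: ds', Run.cons (a := some t) hstep (by simp) h'⟩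

theorem Run.comapOption {M : CounterMachine α σ k} {f : τ → Option α} {q q' : σ}
    {c c' : Fin k → ℕ} {v : List α} {ds : List (Fin k → SignType)} (h : M.Run q c v ds q' c') :
    ∀ w : List τ, w.filterMap f = v → ∃ ds', (M.comapOption f).Run q c w ds' q' c' := by
  induction h with
  | nil q c =>
    intro w hw
    simpa using Run.comapOption_erased w (List.filterMap_eq_nil_iff.1 hw) (Run.nil q c)
  | @cons q r q' c e c' x d v ds hstep hcount _ ih =>
    intro w hw
    rcases x with _ | a
    · obtain ⟨ds', h⟩ := ih w (by simpa using hw)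
      exact ⟨d :: ds', Run.cons (a := none) hstep hcount h⟩
    · obtain ⟨u, t, w', rfl, hu, ht, hw'⟩ := List.filterMap_eq_cons_iff.1 hw
      obtain ⟨ds', h⟩ := ih w' hw'
      refine Run.comapOption_erased u hu (Run.cons (a := some t) (d := d) ?_ hcount h)
      simpa [CounterMachine.comapOption, ht] using hstep

end CounterMachine

theorem flatMap_toList_eq_filterMap {α τ : Type} (f : τ → Option α) (w : List τ) :
    w.flatMap (fun t => (f t).toList) = w.filterMap f := by
  induction w with
  | nil => rfl
  | cons t w ih => cases h : f t <;> simp [h, ih]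

theorem NCM_homPreimage_option {α τ : Type} [Finite α] [Finite τ] (f : τ → Option α)
    {L : Language α} (hL : L ∈ NCM α) : L.homPreimage (fun t => (f t).toList) ∈ NCM τ := by
  obtain ⟨k, l, σ, hσ, M, hM, rfl⟩ := hL
  refine ⟨k, l, σ, hσ, M.comapOption f, ?_, ?_⟩
  · rintro w ds ⟨q, hq, c, h⟩ i
    obtain ⟨ds', h', hds⟩ := h.of_comapOption
    have := hM _ ds' ⟨q, hq, c, h'⟩ i
    rwa [CounterMachine.reversals, hds i] at this
  · ext w
    constructor
    · rintro ⟨ds, q, hq, c, h⟩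
      obtain ⟨ds', h', -⟩ := h.of_comapOption
      exact ⟨ds', q, hq, c, h'⟩
    · rintro ⟨ds, q, hq, c, h⟩
      obtain ⟨ds', h'⟩ := h.comapOption w (flatMap_toList_eq_filterMap f w).symm
      exact ⟨ds', q, hq, c, h'⟩

/-! ### The closure of a family under homomorphism -/

namespace LanguageFamily

/-- The family of all homomorphic images of languages in `F`. -/
def homClosure (F : LanguageFamily) : LanguageFamily := fun β _ =>
  {L | ∃ (α : Type) (_ : Finite α) (h : α → List β), ∃ L' ∈ F α, L'.homImage h = L}

theorem contained_homClosure (F : LanguageFamily) : F.Contained F.homClosure := by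
  intro α _ L hL
  refine ⟨α, inferInstance, fun a => [a], L, hL, ?_⟩
  ext w
  constructor
  · rintro ⟨v, hv, rfl⟩
    simpa using hv
  · exact fun hw => ⟨w, hw, by simp⟩

theorem closedUnderHom_homClosure (F : LanguageFamily) : F.homClosure.ClosedUnderHom := by
  rintro β γ _ _ g _ ⟨α, _, h, L, hL, rfl⟩
  refine ⟨α, inferInstance, fun a => (h a).flatMap g, L, hL, ?_⟩
  ext w
  constructor
  · rintro ⟨v, hv, rfl⟩
    exact ⟨_, ⟨v, hv, rfl⟩, List.flatMap_assoc⟩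
  · rintro ⟨_, ⟨v, hv, rfl⟩, rfl⟩
    exact ⟨v, hv, List.flatMap_assoc.symm⟩

theorem homClosure_contained {F G : LanguageFamily} (h : F.Contained G) (hG : G.ClosedUnderHom) :
    F.homClosure.Contained G := by
  rintro β _ _ ⟨α, _, g, L, hL, rfl⟩
  exact hG α β g L (h α L hL)

theorem hatH_eq_homClosure (F : LanguageFamily) : F.hatH = F.homClosure := by
  funext α _
  ext L
  exact ⟨fun h => h _ F.contained_homClosure F.closedUnderHom_homClosure,
    fun h G hFG hG => homClosure_contained hFG hG α L h⟩

theorem hatT_eq_homClosure {F : LanguageFamily} (hF : F.homClosure.IsFullTrio) :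
    F.hatT = F.homClosure := by
  funext α _
  ext L
  exact ⟨fun h => h _ F.contained_homClosure hF,
    fun h G hFG hG => homClosure_contained hFG hG.hom α L h⟩

/-- In both closure proofs the regular language is absorbed into the factor from `F`, so `G` needs
no closure under regular intersection. -/
theorem isFullTrio_homClosure_wedge {F G : LanguageFamily} (hF : F.IsFullTrio)
    (hG : ∀ (α τ : Type) [Finite α] [Finite τ] (f : τ → Option α) (L : Language α), L ∈ G α →
      L.homPreimage (fun t => (f t).toList) ∈ G τ) : (F.wedge G).homClosure.IsFullTrio where
  hom := closedUnderHom_homClosure _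
  invHom := by
    rintro γ β _ _ g _ ⟨α, _, h, _, ⟨L₁, hL₁, L₂, hL₂, rfl⟩, rfl⟩
    obtain ⟨R, hR, hsync⟩ := exists_isRegular_synchronizing g h
    refine ⟨γ ⊕ β ⊕ α, inferInstance, fun x => (keepLeft x).toList, _,
      ⟨_, hF.interRegular _ _ _ (hF.invHom _ _ (fun x => (keepRight x).toList) L₁ hL₁) hR,
        _, hG _ _ keepRight L₂ hL₂, rfl⟩, ?_⟩
    ext u
    constructor
    · rintro ⟨w, ⟨⟨h₁, hw⟩, h₂⟩, rfl⟩
      exact ⟨_, ⟨h₁, h₂⟩, ((hsync _ _).2 ⟨w, hw, rfl, rfl⟩).symm⟩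
    · rintro ⟨v, ⟨h₁, h₂⟩, hv⟩
      obtain ⟨w, hw, rfl, rfl⟩ := (hsync u v).1 hv.symm
      exact ⟨w, ⟨⟨h₁, hw⟩, h₂⟩, rfl⟩
  interRegular := by
    rintro β _ _ R ⟨α, _, h, _, ⟨L₁, hL₁, L₂, hL₂, rfl⟩, rfl⟩ hR
    refine ⟨α, inferInstance, h, _,
      ⟨_, hF.interRegular _ _ _ hL₁ (hR.homPreimage h), L₂, hL₂, rfl⟩, ?_⟩
    ext u
    constructor
    · rintro ⟨w, ⟨⟨h₁, hw⟩, h₂⟩, rfl⟩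
      exact ⟨⟨w, ⟨h₁, h₂⟩, rfl⟩, hw⟩
    · rintro ⟨⟨w, ⟨h₁, h₂⟩, rfl⟩, hw⟩
      exact ⟨w, ⟨⟨h₁, hw⟩, h₂⟩, rfl⟩

end LanguageFamily

/-! ### Phases of a single counter

The computation of a counter is divided into phases, whose kind is their index modulo 5: a single
step from zero up (`0`), steps up from positive values (`1`), steps down to positive values (`2`),
a single step down to zero (`3`), and steps that leave the value zero unchanged (`4`). -/

/-- A step of phase `p'` may come after a step of phase `p`. -/
def PhaseLe (p p' : ℕ) : Prop := p < p' ∨ p = p' ∧ p % 5 ≠ 0 ∧ p % 5 ≠ 3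

theorem PhaseLe.trans {p q r : ℕ} (h : PhaseLe p q) (h' : PhaseLe q r) : PhaseLe p r := by
  unfold PhaseLe at *
  omega

theorem PhaseLe.le {p q : ℕ} (h : PhaseLe p q) : p ≤ q := by
  unfold PhaseLe at h
  omega

/-- Whether the counter is zero before the steps of phase `p`. -/
def phaseZero (p : ℕ) : Bool := decide (p % 5 = 0 ∨ p % 5 = 4)

/-- In phase `p` the counter may be changed by `d`. -/
def PhaseChange (p : ℕ) (d : ℤ) : Prop :=
  (p % 5 = 0 → d = 1) ∧ (p % 5 = 1 → 0 ≤ d) ∧ (p % 5 = 2 → d ≤ 0) ∧ (p % 5 = 3 → d = -1) ∧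
    (p % 5 = 4 → d = 0)

/-- In phase `p` the counter may be changed from `v` to `v + d`. -/
def PhaseStep (p : ℕ) (v d : ℤ) : Prop :=
  (p % 5 = 0 → v = 0 ∧ d = 1) ∧ (p % 5 = 1 → 0 < v ∧ 0 ≤ d) ∧ (p % 5 = 2 → 0 < v + d ∧ d ≤ 0) ∧
    (p % 5 = 3 → v = 1 ∧ d = -1) ∧ (p % 5 = 4 → v = 0 ∧ d = 0)

/-- Phase `p` may change the counter from `A` to `A'`. -/
def PhaseCond (p : ℕ) (A A' : ℤ) : Prop :=
  (p % 5 = 0 → A = 0) ∧ (p % 5 = 1 → 0 < A) ∧ (p % 5 = 2 → 0 < A') ∧ (p % 5 = 3 → A = 1) ∧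
    (p % 5 = 4 → A = 0)

theorem PhaseStep.change {p : ℕ} {v d : ℤ} (h : PhaseStep p v d) : PhaseChange p d :=
  ⟨fun e => (h.1 e).2, fun e => (h.2.1 e).2, fun e => (h.2.2.1 e).2, fun e => (h.2.2.2.1 e).2,
    fun e => (h.2.2.2.2 e).2⟩

theorem PhaseStep.phaseZero_iff {p : ℕ} {v d : ℤ} (h : PhaseStep p v d) :
    phaseZero p = true ↔ v = 0 := by
  simp only [phaseZero, decide_eq_true_eq]
  unfold PhaseStep at h
  omega

theorem PhaseStep.nonneg {p : ℕ} {v d : ℤ} (h : PhaseStep p v d) : 0 ≤ v + d := by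
  unfold PhaseStep at h
  omega

/-- From the value `v` on, the steps of the list, given by phase and change, are possible. -/
def PhaseSteps : ℤ → List (ℕ × SignType) → Prop
  | _, [] => True
  | v, x :: l => PhaseStep x.1 v x.2 ∧ PhaseSteps (v + x.2) l

/-- The total change in the phases before phase `j`. -/
def changeBefore (j : ℕ) (l : List (ℕ × SignType)) : ℤ :=
  (l.map fun x => if x.1 < j then (x.2 : ℤ) else 0).sum

theorem changeBefore_cons_of_lt {j : ℕ} {x : ℕ × SignType} (h : x.1 < j)
    (l : List (ℕ × SignType)) : changeBefore j (x :: l) = x.2 + changeBefore j l := by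
  simp [changeBefore, h]

theorem changeBefore_eq_zero {j : ℕ} {l : List (ℕ × SignType)} (h : ∀ x ∈ l, j ≤ x.1) :
    changeBefore j l = 0 := by
  refine List.sum_eq_zero fun z hz => ?_
  obtain ⟨x, hx, rfl⟩ := List.mem_map.1 hz
  exact if_neg (not_lt.2 (h x hx))

theorem changeBefore_succ_nonpos {j : ℕ} {l : List (ℕ × SignType)} (hj : j % 5 = 2)
    (h : ∀ x ∈ l, j ≤ x.1) (hl : ∀ x ∈ l, PhaseChange x.1 x.2) : changeBefore (j + 1) l ≤ 0 := by
  induction l with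
  | nil => exact le_rfl
  | cons x l ih =>
    have h1 := ih (fun y hy => h y (List.mem_cons_of_mem _ hy))
      fun y hy => hl y (List.mem_cons_of_mem _ hy)
    have h2 := h x List.mem_cons_self
    have h3 := (hl x List.mem_cons_self).2.2.1
    rw [changeBefore, List.map_cons, List.sum_cons, ← changeBefore]
    split_ifs with hxj
    · have := h3 (by omega)
      omega
    · omega

/-- As the phases are ordered, `v + changeBefore j l` is the value on entering phase `j`. A rising
phase is lowest at its start and a falling one at its end, so positivity there gives it at every
step; the other kinds are single steps or constant. The right-hand side does not depend on the order
of the steps. -/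
theorem phaseSteps_iff (l : List (ℕ × SignType)) (hl : l.Pairwise fun x y => PhaseLe x.1 y.1) :
    ∀ v, PhaseSteps v l ↔ (∀ x ∈ l, PhaseChange x.1 x.2) ∧
      ∀ j, (∀ x ∈ l, x.1 ≠ j) ∨ PhaseCond j (v + changeBefore j l) (v + changeBefore (j + 1) l) := by
  induction l with
  | nil => intro v; simp [PhaseSteps]
  | cons x l ih =>
    intro v
    obtain ⟨hx, hl⟩ := List.pairwise_cons.1 hl
    have hle : ∀ y ∈ l, x.1 ≤ y.1 := fun y hy => (hx y hy).le
    have hzero := changeBefore_eq_zero hle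
    have hcons : changeBefore x.1 (x :: l) = 0 :=
      changeBefore_eq_zero (List.forall_mem_cons.2 ⟨le_rfl, hle⟩)
    have hsucc : changeBefore (x.1 + 1) (x :: l) = x.2 + changeBefore (x.1 + 1) l :=
      changeBefore_cons_of_lt (Nat.lt_succ_self x.1) l
    rw [PhaseSteps, ih hl]
    constructor
    · rintro ⟨hstep, hchange, hcond⟩
      refine ⟨List.forall_mem_cons.2 ⟨hstep.change, hchange⟩, fun j => ?_⟩
      rcases lt_trichotomy x.1 j with hj | rfl | hj
      · rw [changeBefore_cons_of_lt hj, changeBefore_cons_of_lt (Nat.lt_succ_of_lt hj),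
          List.forall_mem_cons, ← add_assoc, ← add_assoc]
        exact (hcond j).imp_left fun h => ⟨hj.ne, h⟩
      · right
        -- The phase ends either after later steps, covered by the induction hypothesis, or right
        -- after `x`, where its own step condition applies.
        have h2 : x.1 % 5 = 2 → 0 < v + x.2 + changeBefore (x.1 + 1) l := by
          intro h2
          rcases hcond x.1 with h | h
          · rw [changeBefore_eq_zero fun y hy => lt_of_le_of_ne (hle y hy) (h y hy).symm]
            have := hstep.2.2.1 h2
            omega
          · exact h.2.2.1 h2
        unfold PhaseCond
        unfold PhaseStep at hstep
        rw [hcons, hsucc]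
        omega
      · left
        refine List.forall_mem_cons.2 ⟨hj.ne', fun y hy => (hj.trans_le (hle y hy)).ne'⟩
    · rintro ⟨hchange, hcond⟩
      obtain ⟨hx2, hchange⟩ := List.forall_mem_cons.1 hchange
      have hx1 : PhaseCond x.1 v (v + x.2 + changeBefore (x.1 + 1) l) := by
        have := (hcond x.1).resolve_left fun h => h x List.mem_cons_self rfl
        rwa [hcons, hsucc, add_zero, ← add_assoc] at this
      have hnonpos : x.1 % 5 = 2 → changeBefore (x.1 + 1) l ≤ 0 := fun h =>
        changeBefore_succ_nonpos h hle hchange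
      refine ⟨?_, hchange, fun j => ?_⟩
      · unfold PhaseStep
        unfold PhaseCond at hx1
        unfold PhaseChange at hx2
        omega
      · rcases lt_trichotomy x.1 j with hj | rfl | hj
        · have := hcond j
          rw [changeBefore_cons_of_lt hj, changeBefore_cons_of_lt (Nat.lt_succ_of_lt hj),
            List.forall_mem_cons, ← add_assoc, ← add_assoc] at this
          exact this.imp_left And.right
        -- Phases of kinds 0 and 3 consist of one step, so none of their steps remain in the tail.
        · by_cases hk : x.1 % 5 = 0 ∨ x.1 % 5 = 3
          · left
            intro y hy
            have := hx y hy
            unfold PhaseLe at this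
            omega
          · right
            unfold PhaseCond at *
            unfold PhaseChange at hx2
            rw [hzero]
            omega
        · exact .inl fun y hy => (hj.trans_le (hle y hy)).ne'

/-- The last direction of change in phase `p`. -/
def phaseDir (p : ℕ) : SignType := if p % 5 ≤ 1 then 1 else -1

open CounterMachine in
/-- A bound for the indices of the phases that are needed, from phase `p` on, for a sequence of
changes of a counter. -/
def phaseBound (p : ℕ) (l : List SignType) : ℕ :=
  5 * (p / 5 + alternations (phaseDir p :: l.filter (fun s => s ≠ 0))) + 4

/-- The counter may have the value `v` after a step of phase `p`. -/
def PhaseValue (p v : ℕ) : Prop := (p % 5 ≤ 2 → 0 < v) ∧ (3 ≤ p % 5 → v = 0)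

theorem le_phaseBound (p : ℕ) (l : List SignType) : p ≤ phaseBound p l := by
  unfold phaseBound
  omega

open CounterMachine in
-- Counters start at zero in phase 4, whose direction counts as downward; prepending it costs at
-- most one alternation. Hence the `5 * l + 10` phases used later.
theorem phaseBound_four_le (l : List SignType) : phaseBound 4 l ≤ 5 * reversals l + 9 := by
  have key : ∀ L, alternations (-1 :: L) ≤ 1 + alternations L := by
    rintro (_ | ⟨a, L⟩)
    · simp [alternations]
    · rw [alternations]
      split_ifs <;> omega
  have : alternations (-1 :: l.filter (fun s => s ≠ 0)) ≤ 1 + reversals l := key _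
  have h4 : phaseDir 4 = -1 := rfl
  unfold phaseBound
  rw [h4]
  omega

/-- Five consecutive phases form one rise and fall. Only an upward step after the fall has begun
opens a new block of five, and it is paid for by an alternation; all other steps fit into the
current block. -/
theorem exists_phase {p c e : ℕ} {d : SignType} (hp : PhaseValue p c)
    (he : (e : ℤ) = c + d) (l : List SignType) :
    ∃ p', PhaseLe p p' ∧ PhaseStep p' c d ∧ PhaseValue p' e ∧
      phaseBound p' l ≤ phaseBound p (d :: l) := by
  have hup : ∀ C, phaseDir (5 * C) = 1 ∧ phaseDir (5 * C + 1) = 1 := fun C =>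
    ⟨if_pos (by omega), if_pos (by omega)⟩
  have hdown : ∀ C, phaseDir (5 * C + 2) = -1 ∧ phaseDir (5 * C + 3) = -1 ∧
      phaseDir (5 * C + 4) = -1 := fun C =>
    ⟨if_neg (by omega), if_neg (by omega), if_neg (by omega)⟩
  unfold PhaseValue at *
  unfold PhaseLe PhaseStep
  -- `C` numbers the block of five phases and `r` is the kind.
  obtain ⟨C, r, hr, rfl⟩ : ∃ C r, r < 5 ∧ p = 5 * C + r := ⟨p / 5, p % 5, by omega, by omega⟩
  obtain rfl | rfl | rfl := d.trichotomy
  · have hd : ((-1 : SignType) : ℤ) = -1 := rfl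
    rw [hd] at he ⊢
    have hb : ∀ x, phaseDir x = -1 → x / 5 = C →
        phaseBound x l ≤ phaseBound (5 * C + r) (-1 :: l) := by
      intro x hx hC
      unfold phaseBound
      rw [hx, List.filter_cons_of_pos (by decide), CounterMachine.alternations]
      omega
    by_cases h0 : e = 0
    · exact ⟨5 * C + 3, by omega, by omega, by omega, hb _ (hdown C).2.1 (by omega)⟩
    · exact ⟨5 * C + 2, by omega, by omega, by omega, hb _ (hdown C).1 (by omega)⟩
  · have hd : ((0 : SignType) : ℤ) = 0 := rfl
    rw [hd] at he ⊢
    have hb : ∀ x, phaseDir x = phaseDir (5 * C + r) → x / 5 = C →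
        phaseBound x l ≤ phaseBound (5 * C + r) (0 :: l) := by
      intro x hx hC
      unfold phaseBound
      rw [hx, List.filter_cons_of_neg (by decide)]
      omega
    have : r = 0 ∨ r = 1 ∨ r = 2 ∨ r = 3 ∨ r = 4 := by omega
    obtain rfl | rfl | rfl | rfl | rfl := this
    · exact ⟨5 * C + 1, by omega, by omega, by omega,
        hb _ ((hup C).2.trans (hup C).1.symm) (by omega)⟩
    · exact ⟨5 * C + 1, by omega, by omega, by omega, hb _ rfl (by omega)⟩
    · exact ⟨5 * C + 2, by omega, by omega, by omega, hb _ rfl (by omega)⟩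
    · exact ⟨5 * C + 4, by omega, by omega, by omega,
        hb _ ((hdown C).2.2.trans (hdown C).2.1.symm) (by omega)⟩
    · exact ⟨5 * C + 4, by omega, by omega, by omega, hb _ rfl (by omega)⟩
  · have hd : ((1 : SignType) : ℤ) = 1 := rfl
    rw [hd] at he ⊢
    by_cases h1 : r ≤ 1
    · refine ⟨5 * C + 1, by omega, by omega, by omega, ?_⟩
      unfold phaseBound
      rw [(hup C).2, List.filter_cons_of_pos (by decide), CounterMachine.alternations]
      omega
    · have hdir : phaseDir (5 * C + r) = -1 := if_neg (by omega)
      have hb : ∀ x, phaseDir x = 1 → x / 5 = C + 1 →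
          phaseBound x l ≤ phaseBound (5 * C + r) (1 :: l) := by
        intro x hx hC
        unfold phaseBound
        rw [hx, hdir, List.filter_cons_of_pos (by decide), CounterMachine.alternations,
          if_neg (by decide)]
        omega
      by_cases h0 : c = 0
      · exact ⟨5 * (C + 1), by omega, by omega, by omega, hb _ (hup _).1 (by omega)⟩
      · exact ⟨5 * (C + 1) + 1, by omega, by omega, by omega, hb _ (hup _).2 (by omega)⟩

/-! ### Semilinearity of intersections with counter languages -/

namespace CounterMachine

variable {α σ : Type} {k : ℕ}

/-- The phases and the changes of counter `i` in a sequence of labelled steps. -/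
def track {N : ℕ} (i : Fin k) (w : List (Option α × (Fin k → Fin N × SignType))) :
    List (ℕ × SignType) :=
  w.map fun t => ((t.2 i).1, (t.2 i).2)

/-- The automaton that reads the steps of a computation of `M`, labelled with the phases of the
counters, and checks everything except the values of the counters. -/
def phaseNFA (M : CounterMachine α σ k) (N : ℕ) (p₀ : Fin N) :
    NFA (Option α × (Fin k → Fin N × SignType)) (σ × (Fin k → Fin N)) where
  step s t := {s' | (∀ i, s'.2 i = (t.2 i).1 ∧ PhaseLe (s.2 i) (t.2 i).1 ∧
      PhaseChange (t.2 i).1 (t.2 i).2) ∧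
    (s'.1, fun i => (t.2 i).2) ∈ M.step s.1 t.1 (fun i => phaseZero (t.2 i).1)}
  start := {(M.start, fun _ => p₀)}
  accept := {s | s.1 ∈ M.accept}

theorem track_of_mem_acceptsFrom {M : CounterMachine α σ k} {N : ℕ} {p₀ : Fin N} (i : Fin k)
    (w : List (Option α × (Fin k → Fin N × SignType))) :
    ∀ s, w ∈ (M.phaseNFA N p₀).acceptsFrom {s} →
      (track i w).Pairwise (fun x y => PhaseLe x.1 y.1) ∧
      ∀ x ∈ track i w, PhaseLe (s.2 i) x.1 ∧ PhaseChange x.1 x.2 := by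
  induction w with
  | nil => intro s _; simp [track]
  | cons t w ih =>
    intro s hs
    rw [NFA.cons_mem_acceptsFrom_singleton] at hs
    obtain ⟨s', ⟨h, -⟩, hw⟩ := hs
    obtain ⟨h1, h2, h3⟩ := h i
    obtain ⟨hp, hx⟩ := ih s' hw
    rw [h1] at hx
    exact ⟨List.pairwise_cons.2 ⟨fun x hxw => (hx x hxw).1, hp⟩,
      List.forall_mem_cons.2 ⟨⟨h2, h3⟩, fun x hxw => ⟨h2.trans (hx x hxw).1, (hx x hxw).2⟩⟩⟩

/-- The automaton takes its zero tests from the guessed phases; `PhaseSteps` certifies that these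
guesses are correct and that no counter becomes negative. -/
theorem exists_run_of_phaseSteps {M : CounterMachine α σ k} {N : ℕ} {p₀ : Fin N}
    (w : List (Option α × (Fin k → Fin N × SignType))) :
    ∀ s (c : Fin k → ℕ), w ∈ (M.phaseNFA N p₀).acceptsFrom {s} →
      (∀ i, PhaseSteps (c i) (track i w)) →
      ∃ ds, ∃ q ∈ M.accept, ∃ c', M.Run s.1 c (w.flatMap fun t => t.1.toList) ds q c' := by
  induction w with
  | nil =>
    intro s c hs _
    obtain ⟨s', hs', hacc⟩ := (NFA.nil_mem_acceptsFrom _).1 hs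
    rw [Set.mem_singleton_iff.1 hs'] at hacc
    exact ⟨[], _, hacc, c, .nil _ _⟩
  | cons t w ih =>
    intro s c hs hc
    rw [NFA.cons_mem_acceptsFrom_singleton] at hs
    obtain ⟨s', ⟨-, h⟩, hw⟩ := hs
    have hstep : ∀ i, PhaseStep (t.2 i).1 (c i) (t.2 i).2 := fun i => (hc i).1
    have he : ∀ i, ((((c i : ℤ) + (t.2 i).2).toNat : ℕ) : ℤ) = (c i : ℤ) + (t.2 i).2 := fun i =>
      Int.toNat_of_nonneg (hstep i).nonneg
    obtain ⟨ds, q, hq, c', hrun⟩ := ih s' (fun i => ((c i : ℤ) + (t.2 i).2).toNat) hw fun i => by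
      rw [he]
      exact (hc i).2
    have hz : (fun i => phaseZero (t.2 i).1) = fun i => decide (c i = 0) := by
      funext i
      rw [Bool.eq_iff_iff, (hstep i).phaseZero_iff]
      simp
    rw [hz] at h
    exact ⟨_ :: ds, q, hq, c', Run.cons h he hrun⟩

/-- Phases are chosen step by step, independently for each counter. The invariant on `phaseBound`
keeps all later labels below `N`. -/
theorem Run.exists_phaseSteps {M : CounterMachine α σ k} {N : ℕ} {p₀ : Fin N} {q q' : σ}
    {c c' : Fin k → ℕ} {v : List α} {ds : List (Fin k → SignType)} (h : M.Run q c v ds q' c')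
    (hq' : q' ∈ M.accept) : ∀ p : Fin k → Fin N,
      (∀ i, PhaseValue (p i) (c i) ∧ phaseBound (p i) (ds.map fun d => d i) < N) →
      ∃ w ∈ (M.phaseNFA N p₀).acceptsFrom {(q, p)},
        w.flatMap (fun t => t.1.toList) = v ∧ ∀ i, PhaseSteps (c i) (track i w) := by
  induction h with
  | nil q c =>
    intro p _
    exact ⟨[], (NFA.nil_mem_acceptsFrom _).2 ⟨_, rfl, hq'⟩, rfl, fun _ => trivial⟩
  | @cons q r q' c e c' a d v ds hstep hcount _ ih =>
    intro p hp
    choose p' h1 h2 h3 h4 using fun i =>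
      exists_phase (hp i).1 (hcount i) (ds.map fun d => d i)
    have hb : ∀ i, phaseBound (p' i) (ds.map fun d => d i) < N := fun i =>
      (h4 i).trans_lt (hp i).2
    have hN : ∀ i, p' i < N := fun i => (le_phaseBound _ _).trans_lt (hb i)
    obtain ⟨w, hw, hv, hc⟩ := ih hq' (fun i => ⟨p' i, hN i⟩) fun i => ⟨h3 i, hb i⟩
    refine ⟨(a, fun i => (⟨p' i, hN i⟩, d i)) :: w,
      (NFA.cons_mem_acceptsFrom_singleton _ _ _ _).2
        ⟨(r, fun i => ⟨p' i, hN i⟩), ⟨fun i => ⟨rfl, h1 i, (h2 i).change⟩, ?_⟩, hw⟩,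
      by simp [hv], fun i => ⟨h2 i, ?_⟩⟩
    · have hz : (fun i => phaseZero (p' i)) = fun i => decide (c i = 0) := by
        funext i
        rw [Bool.eq_iff_iff, (h2 i).phaseZero_iff]
        simp
      simpa [hz] using hstep
    · have := hc i
      rwa [hcount i] at this

theorem isSemilinearSet_phaseCond {X : Type} [AddCommMonoid X] [AddMonoid.FG X] (j : ℕ)
    (f g : X →+ ℤ) : IsSemilinearSet {x | PhaseCond j (f x) (g x)} := by
  have heq : ∀ a, IsSemilinearSet {x | f x = a} := fun a =>
    (IsSemilinearSet.singleton a).preimage f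
  have : j % 5 = 0 ∨ j % 5 = 1 ∨ j % 5 = 2 ∨ j % 5 = 3 ∨ j % 5 = 4 := by omega
  obtain h | h | h | h | h := this <;> simp only [PhaseCond, h]
  · simpa using heq 0
  · simpa using isSemilinearSet_pos_int.preimage f
  · simpa using isSemilinearSet_pos_int.preimage g
  · simpa using heq 1
  · simpa using heq 0

/-- The Parikh vectors of the sequences of labelled steps in which the values of the counters
agree with the phases. -/
def phaseVectors (α : Type) [Finite α] (k N : ℕ) :
    Set (Option α × (Fin k → Fin N × SignType) → ℕ) :=
  ⋂ i : Fin k, ⋂ j : Fin N,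
    {x | weightHom (fun t => if (t.2 i).1 = j then 1 else 0) x = 0} ∪
    {x | PhaseCond j
      (weightHom (fun t => if ((t.2 i).1 : ℕ) < j then ((t.2 i).2 : ℤ) else 0) x)
      (weightHom (fun t => if ((t.2 i).1 : ℕ) < j + 1 then ((t.2 i).2 : ℤ) else 0) x)}

theorem isSemilinearSet_phaseVectors (α : Type) [Finite α] (k N : ℕ) :
    IsSemilinearSet (phaseVectors α k N) :=
  .iInter fun _ => .iInter fun j =>
    ((IsSemilinearSet.singleton (0 : ℕ)).preimage _).union (isSemilinearSet_phaseCond j _ _)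

/-- The boundary values in `phaseSteps_iff`, and the number of steps in a phase, are sums of weights
of letters, hence additive functions of the Parikh vector. -/
theorem parikh_mem_phaseVectors_iff [Finite α] {N : ℕ}
    (w : List (Option α × (Fin k → Fin N × SignType)))
    (hw : ∀ i, (track i w).Pairwise (fun x y => PhaseLe x.1 y.1) ∧
      ∀ x ∈ track i w, PhaseChange x.1 x.2) :
    parikh w ∈ phaseVectors α k N ↔ ∀ i, PhaseSteps 0 (track i w) := by
  simp only [phaseVectors, Set.mem_iInter]
  refine forall_congr' fun i => ?_
  rw [phaseSteps_iff _ (hw i).1, and_iff_right (hw i).2]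
  have hbefore : ∀ j, 0 + changeBefore j (track i w) =
      (w.map fun t => if ((t.2 i).1 : ℕ) < j then ((t.2 i).2 : ℤ) else 0).sum := fun j => by
    rw [zero_add, changeBefore, track, List.map_map]
    rfl
  have hnone : ∀ j : Fin N, (w.map fun t => if (t.2 i).1 = j then 1 else 0).sum = 0 ↔
      ∀ x ∈ track i w, x.1 ≠ j := fun j => by
    rw [List.sum_eq_zero_iff]
    constructor
    · intro h x hx e
      obtain ⟨t, ht, rfl⟩ := List.mem_map.1 hx
      have := h _ (List.mem_map_of_mem ht)
      rw [if_pos (Fin.ext e)] at this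
      exact one_ne_zero this
    · intro h z hz
      obtain ⟨t, ht, rfl⟩ := List.mem_map.1 hz
      exact if_neg fun e => h _ (List.mem_map_of_mem ht) (congrArg Fin.val e)
  simp only [Set.mem_union, Set.mem_ofPred_eq, weightHom_parikh, hbefore, hnone]
  constructor
  · intro h j
    -- Phases from `N` on carry no steps, as the labels lie in `Fin N`.
    by_cases hj : j < N
    · exact h ⟨j, hj⟩
    · left
      intro x hx
      obtain ⟨t, -, rfl⟩ := List.mem_map.1 hx
      exact fun e => hj (e ▸ (t.2 i).1.2)
  · exact fun h j => h j

/-- The reversal bound ensures that the phases of every accepting computation fit below `5 * l +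
10`; conversely, a labelled word with consistent values is itself a computation. -/
theorem ReversalBounded.mem_accepts_iff [Finite α] {M : CounterMachine α σ k} {l : ℕ}
    (hM : M.ReversalBounded l) (v : List α) : v ∈ M.accepts ↔
      ∃ w ∈ (M.phaseNFA (5 * l + 10) ⟨4, by omega⟩).accepts,
        w.flatMap (fun t => t.1.toList) = v ∧ parikh w ∈ phaseVectors α k (5 * l + 10) := by
  have hiff : ∀ w ∈ (M.phaseNFA (5 * l + 10) ⟨4, by omega⟩).accepts,
      (parikh w ∈ phaseVectors α k (5 * l + 10) ↔ ∀ i, PhaseSteps 0 (track i w)) := by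
    intro w hw
    refine parikh_mem_phaseVectors_iff w fun i => ?_
    have := track_of_mem_acceptsFrom i w _ hw
    exact ⟨this.1, fun x hx => (this.2 x hx).2⟩
  constructor
  · rintro ⟨ds, q, hq, c, h⟩
    obtain ⟨w, hw, hv, hs⟩ := h.exists_phaseSteps (p₀ := ⟨4, by omega⟩) hq
      (fun _ => (⟨4, by omega⟩ : Fin (5 * l + 10))) fun i => by
        refine ⟨⟨by simp, by simp⟩, ?_⟩
        have h1 := phaseBound_four_le (ds.map fun d => d i)
        have h2 := hM v ds ⟨q, hq, c, h⟩ i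
        simp only
        omega
    exact ⟨w, hw, hv, (hiff w hw).2 (by simpa using hs)⟩
  · rintro ⟨w, hw, rfl, hs⟩
    obtain ⟨ds, q, hq, c, h⟩ := exists_run_of_phaseSteps w _ 0 hw
      (by simpa using (hiff w hw).1 hs)
    exact ⟨ds, q, hq, c, h⟩

end CounterMachine

namespace LanguageFamily

open CounterMachine in
theorem isSemilinear_wedge_NCM {F : LanguageFamily} (hF : F.IsFullTrio) (hs : F.IsSemilinear) :
    (F.wedge NCM).IsSemilinear := by
  rintro α _ _ ⟨L, hL, _, ⟨k, l, σ, _, M, hM, rfl⟩, rfl⟩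
  let f : Option α × (Fin k → Fin (5 * l + 10) × SignType) → List α := fun t => t.1.toList
  have hreg := (M.phaseNFA (5 * l + 10) ⟨4, by omega⟩).isRegular_accepts
  have hmem := hF.interRegular _ _ _ (hF.invHom _ _ f L hL) hreg
  -- The condition on counter values depends only on the Parikh vector, so it can be imposed on the
  -- Parikh image of f⁻¹(L) ∩ R, with R the regular language of `phaseNFA`, instead of on the
  -- language.
  have := ((hs _ _ hmem).inter (isSemilinearSet_phaseVectors α k _)).image
    (weightHom fun t => parikh (f t))
  unfold Language.IsSemilinear
  convert this using 1
  ext x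
  constructor
  · rintro ⟨v, ⟨hv, hvM⟩, rfl⟩
    obtain ⟨w, hw, rfl, hx⟩ := (hM.mem_accepts_iff v).1 hvM
    exact ⟨parikh w, ⟨⟨w, ⟨hv, hw⟩, rfl⟩, hx⟩, (parikh_flatMap f w).symm⟩
  · rintro ⟨_, ⟨⟨w, ⟨hv, hw⟩, rfl⟩, hx⟩, rfl⟩
    exact ⟨w.flatMap f, ⟨hv, (hM.mem_accepts_iff _).2 ⟨w, hw, rfl, hx⟩⟩, parikh_flatMap f w⟩

theorem IsSemilinear.homClosure {F : LanguageFamily} (hF : F.IsSemilinear) :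
    F.homClosure.IsSemilinear := by
  rintro β _ _ ⟨α, _, h, L, hL, rfl⟩
  exact (hF α L hL).homImage h

end LanguageFamily

theorem proposition1 (𝓛 : LanguageFamily) (htrio : 𝓛.IsFullTrio) (hsemi : 𝓛.IsSemilinear) :
    (𝓛.wedge NCM).hatT = (𝓛.wedge NCM).hatH ∧
      (𝓛.wedge NCM).hatT.IsFullTrio ∧
      (𝓛.wedge NCM).hatT.IsSemilinear := by
  have htrio' : (𝓛.wedge NCM).homClosure.IsFullTrio :=
    LanguageFamily.isFullTrio_homClosure_wedge htrio fun _ _ _ _ f _ hL =>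
      NCM_homPreimage_option f hL
  rw [LanguageFamily.hatT_eq_homClosure htrio', LanguageFamily.hatH_eq_homClosure]
  exact ⟨rfl, htrio', (LanguageFamily.isSemilinear_wedge_NCM htrio hsemi).homClosure⟩
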